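/- Let $\lambda$ be a $\sigma$-finite Borel measure on $\mathcal Y\subseteq\mathbb R^d$, let $s:\mathcal Y\to\mathbb R$ be measurable, and put $\kappa(\eta)=\log\int_{\mathcal Y}\exp(\eta s(y))\,\lambda(dy)$, $\mathcal E=\{\eta\in\mathbb R:|\kappa(\eta)|<\infty\}$ and $q(y\mid\eta)=\exp(\eta s(y)-\kappa(\eta))$ for $\eta\in\mathcal E$. Assume that $\mathcal E$ is open and nonempty and that $\eta\mapsto Q_\eta$, $Q_\eta(B)=\int_B q(y\mid\eta)\,\lambda(dy)$, is one-to-one on $\mathcal E$. Let $\mathcal X\subseteq\mathbb R^D$, and let $\Theta\subseteq\mathbb R^D$ be open and convex with $\theta^{\mathsf T}x\in\mathcal E$ for all $\theta\in\Theta$, $x\in\mathcal X$. Suppose $(X_1,Y_1),(X_2,Y_2),\ldots\in\mathcal X\times\mathcal Y$ are i.i.d. such that: (1) $f'(\theta_0)=0$ for some $\theta_0\in\Theta$, where $f(\theta)=-\mathbb E\log q(Y_i\mid\theta^{\mathsf T}X_i)$; (2) $\mathbb E|X_i s(Y_i)|<\infty$, and $\mathbb E|\kappa(\theta^{\mathsf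 T}X_i)|<\infty$ for all $\theta\in\Theta$; (3) for all $a\in\mathbb R^D$, if $a^{\mathsf T}X_i=0$ almost surely, then $a=0$; and (4) there is an open ball $E\subseteq\mathbb R^D$ such that $\theta_0\in E$, $\bar E\subseteq\Theta$, and for all $j,k,\ell\in\{1,\ldots,D\}$, $\mathbb E\big(\sup_{\theta\in\bar E}|\kappa'''(\theta^{\mathsf T}X_i)X_{ij}X_{ik}X_{i\ell}|\big)<\infty$. Then for any open ball $E$ satisfying (4), with probability $1$ the functions $f_n(\theta)=-\frac1n\sum_{i=1}^n\log q(Y_i\mid\theta^{\mathsf T}X_i)$, $n\ge1$, satisfy the following conditions (the conditions on the loss functions in the Bernstein–von Mises theorem for generalized posteriors): $E\subseteq\Theta$ is open and bounded with $\theta_0\in E$; each $f_n$ has continuous third derivatives on $E$; $f_n(\theta)\to f(\theta)$ for all $\theta\in\Theta$; $f''(\theta_0)$ exists and is positive definite; $(f_n''')$ is uniformly bounded on $E$, that is, $\sup_{n\ge1}\sup_{\theta\in E}\|f_n'''(\theta)\|<\infty$; and at least one of the following two holds: (a) there is a compact $K\subseteq E$ with $\theta_0$ in the interior of $K$ such that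 $f(\theta)>f(\theta_0)$ for all $\theta\in K\setminus\{\theta_0\}$ and $\liminf_n\inf_{\theta\in\Theta\setminus K}f_n(\theta)>f(\theta_0)$; or (b) each $f_n$ is convex on $\Theta$ and $f'(\theta_0)=0$. -/

import Mathlib

open MeasureTheory ProbabilityTheory Filter Topology

noncomputable section

namespace GLM

section ExpFam

variable {𝓨 : Type*} [MeasurableSpace 𝓨]

/-- The log-partition function `κ(η) = log ∫ exp(η s(y)) ν(dy)` of the one-parameter exponential
family with sufficient statistic `s` and base measure `ν` (meaningful for `η` in
`naturalSpace s ν`). -/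
def logPartition (s : 𝓨 → ℝ) (ν : Measure 𝓨) (η : ℝ) : ℝ :=
  Real.log (∫ y, Real.exp (η * s y) ∂ν)

/-- The natural parameter space `{η : |κ(η)| < ∞}`: the integral `∫ exp(η s(y)) ν(dy)` is
finite (so `κ(η) < ∞`) and positive (so `κ(η) > -∞`). -/
def naturalSpace (s : 𝓨 → ℝ) (ν : Measure 𝓨) : Set ℝ :=
  {η | Integrable (fun y => Real.exp (η * s y)) ν ∧ 0 < ∫ y, Real.exp (η * s y) ∂ν}

/-- The density `q(y | η) = exp(η s(y) - κ(η))`. -/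
def density (s : 𝓨 → ℝ) (ν : Measure 𝓨) (y : 𝓨) (η : ℝ) : ℝ :=
  Real.exp (η * s y - logPartition s ν η)

/-- The distribution `Q_η(B) = ∫_B q(y | η) ν(dy)`. -/
def expFamMeasure (s : 𝓨 → ℝ) (ν : Measure 𝓨) (η : ℝ) : Measure 𝓨 :=
  ν.withDensity (fun y => ENNReal.ofReal (density s ν y η))

/-- The one-parameter exponential family with sufficient statistic `s` and base measure `ν`,
indexed by its full natural parameter space, is regular (open parameter space), nonempty and
identifiable. -/
structure IsRegularExpFam (s : 𝓨 → ℝ) (ν : Measure 𝓨) : Prop where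
  isOpen : IsOpen (naturalSpace s ν)
  nonempty : (naturalSpace s ν).Nonempty
  identifiable : Set.InjOn (expFamMeasure s ν) (naturalSpace s ν)

end ExpFam

/-- `f''(θ₀)` exists and is positive definite: `f` is differentiable near `θ₀`, its derivative is
differentiable at `θ₀`, and the second derivative (which is then automatically symmetric) is a
positive definite bilinear form. -/
def HasPosDefHessianAt {V : Type*} [NormedAddCommGroup V] [NormedSpace ℝ V]
    (f : V → ℝ) (θ₀ : V) : Prop :=
  (∀ᶠ θ in 𝓝 θ₀, DifferentiableAt ℝ f θ) ∧ DifferentiableAt ℝ (fderiv ℝ f) θ₀ ∧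
    ∀ v : V, v ≠ 0 → 0 < fderiv ℝ (fderiv ℝ f) θ₀ v v

/-- The conditions of the Bernstein-von Mises theorem on a sequence `(F n)` for `n ≥ 1` of
real-valued functions on `Θ ⊆ ℝ^D`, with pointwise limit `f` on `Θ`, neighborhood `E ⊆ Θ` and
point `θ₀ ∈ E`. Only the values of `F n` and `f` on `Θ` matter. The infimum and the lower limit
are taken in the extended reals. -/
structure BvMConditions {D : ℕ} (Θ E : Set (EuclideanSpace ℝ (Fin D)))
    (θ₀ : EuclideanSpace ℝ (Fin D)) (F : ℕ → EuclideanSpace ℝ (Fin D) → ℝ)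
    (f : EuclideanSpace ℝ (Fin D) → ℝ) : Prop where
  isOpen : IsOpen E
  isBounded : Bornology.IsBounded E
  subset : E ⊆ Θ
  mem : θ₀ ∈ E
  contDiffOn : ∀ n, 1 ≤ n → ContDiffOn ℝ 3 (F n) E
  tendsto : ∀ θ ∈ Θ, Tendsto (fun n => F n θ) atTop (𝓝 (f θ))
  posDef : HasPosDefHessianAt f θ₀
  third_bounded : ∃ C : ℝ, ∀ n, 1 ≤ n → ∀ θ ∈ E, ‖iteratedFDeriv ℝ 3 (F n) θ‖ ≤ C
  separated_or_convex :
    (∃ K : Set (EuclideanSpace ℝ (Fin D)), IsCompact K ∧ K ⊆ E ∧ θ₀ ∈ interior K ∧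
      (∀ θ ∈ K, θ ≠ θ₀ → f θ₀ < f θ) ∧
      (f θ₀ : EReal) < liminf (fun n => ⨅ θ ∈ Θ \ K, (F n θ : EReal)) atTop) ∨
    ((∀ n, 1 ≤ n → ConvexOn ℝ Θ (F n)) ∧
      HasFDerivAt f (0 : EuclideanSpace ℝ (Fin D) →L[ℝ] ℝ) θ₀)

section Model

variable {D : ℕ} {𝓧 : Set (EuclideanSpace ℝ (Fin D))} {𝓨 : Type*} [MeasurableSpace 𝓨]
  {Ω : Type*} [MeasurableSpace Ω]

/-- The expected loss `f(θ) = -E log q(Y | θᵀX)`. -/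
def expectedLoss (s : 𝓨 → ℝ) (ν : Measure 𝓨) (P : Measure Ω) (X : Ω → 𝓧) (Y : Ω → 𝓨)
    (θ : EuclideanSpace ℝ (Fin D)) : ℝ :=
  -∫ ω, Real.log (density s ν (Y ω) (inner ℝ θ (X ω : EuclideanSpace ℝ (Fin D)))) ∂P

/-- The empirical loss `f_n(θ) = -(1/n) ∑ log q(Y_i | θᵀX_i)`, the sum being over the first `n`
data points (which are indexed from `0`). -/
def empiricalLoss (s : 𝓨 → ℝ) (ν : Measure 𝓨) (X : ℕ → Ω → 𝓧) (Y : ℕ → Ω → 𝓨) (ω : Ω)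
    (n : ℕ) (θ : EuclideanSpace ℝ (Fin D)) : ℝ :=
  -(1 / (n : ℝ)) * ∑ i ∈ Finset.range n,
    Real.log (density s ν (Y i ω) (inner ℝ θ (X i ω : EuclideanSpace ℝ (Fin D))))

end Model

end GLM

end

/-! The loss `-log q(Y | θᵀX)` equals `κ(θᵀX)` minus a term linear in `θ`, so the question is about
`κ` alone. On the natural parameter space `κ` is analytic with `κ'' > 0`: `κ''` is the variance of
`s` under `Q_η`, and zero variance would contradict identifiability
(`IsRegularExpFam.iteratedDeriv_two_pos`). Hence the empirical losses are convex on `Θ`, and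
alternative (b) holds together with the assumed critical point.

For convergence, the strong law gives a null set depending on `θ`. Convexity removes this
dependence: almost sure convergence on a suitable countable set spreads to all of `Θ`
(`tendsto_of_convexOn_of_simplex_vertices`).

The third derivative of an empirical loss does not involve the responses. On the ball it is bounded
by an average of i.i.d. integrable variables `M(X_i)`, which converges almost surely and is
therefore bounded in `n`.

The Hessian of `f` needs moments of `κ'` and `κ''` that are not assumed. Convexity bounds `κ'` by
finite differences of `κ`, and the mean value theorem bounds `κ''` by a difference of `κ'` plus the
third-derivative bound. The resulting dominating functions justify differentiating twice under the
expectation (`hasFDerivAt_fderiv_integral_ridge`). The Hessian form is `E[κ''(θ₀ᵀX) (vᵀX)²]`, which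
vanishes only if `vᵀX = 0` almost surely. -/

noncomputable section

namespace GLM


/-! ### Pointwise convergence of convex functions from a countable set -/

section Convex

variable {V : Type*} [NormedAddCommGroup V] [NormedSpace ℝ V]

/-- A subset of an open set in a finite-dimensional space has countably many points such that every
point of the set lies in an arbitrarily small simplex with vertices among these points. -/
theorem exists_countable_simplex_vertices [FiniteDimensional ℝ V] {Θ : Set V} (hΘ : IsOpen Θ) :
    ∃ A : Set V, A.Countable ∧ A ⊆ Θ ∧ ∀ θ ∈ Θ, ∀ δ > 0, ∃ t : Set V, t.Finite ∧ t.Nonempty ∧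
      t ⊆ A ∧ t ⊆ Metric.ball θ δ ∧ θ ∈ convexHull ℝ t := by
  have key : ∀ m : ℕ, ∃ A : Set V, A.Countable ∧ A ⊆ Θ ∧ ∀ θ ∈ Θ, ∃ t : Set V, t.Finite ∧
      t.Nonempty ∧ t ⊆ A ∧ t ⊆ Metric.ball θ (2 / ((m : ℝ) + 1)) ∧ θ ∈ convexHull ℝ t := by
    intro m
    have hm : (0 : ℝ) < 1 / ((m : ℝ) + 1) := by positivity
    have hb : ∀ x : Θ, ∃ b : AffineBasis (Fin (Module.finrank ℝ V + 1)) ℝ V,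
        (x : V) ∈ interior (convexHull ℝ (Set.range b)) ∧
          convexHull ℝ (Set.range b) ⊆ Θ ∩ Metric.ball (x : V) (1 / ((m : ℝ) + 1)) := fun x =>
      exists_mem_interior_convexHull_affineBasis
        (inter_mem (hΘ.mem_nhds x.2) (Metric.ball_mem_nhds _ hm))
    choose b hb1 hb2 using hb
    -- Lindelöf: countably many of the simplex interiors already cover `Θ`. A point of such a
    -- simplex lies within `1 / (m + 1)` of its centre, as do the vertices, whence the radius `2 /
    -- (m + 1)`.
    obtain ⟨T, hT, hU⟩ := TopologicalSpace.isOpen_iUnion_countable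
      (fun x : Θ => interior (convexHull ℝ (Set.range (b x)))) (fun _ => isOpen_interior)
    refine ⟨⋃ x ∈ T, Set.range (b x), hT.biUnion fun x _ => Set.countable_range _, ?_, ?_⟩
    · exact Set.iUnion₂_subset fun x _ =>
        (subset_convexHull ℝ _).trans ((hb2 x).trans Set.inter_subset_left)
    · intro θ hθ
      have : θ ∈ ⋃ x : Θ, interior (convexHull ℝ (Set.range (b x))) :=
        Set.mem_iUnion.2 ⟨⟨θ, hθ⟩, hb1 ⟨θ, hθ⟩⟩
      rw [← hU] at this
      obtain ⟨x, hxT, hx⟩ := Set.mem_iUnion₂.1 this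
      refine ⟨Set.range (b x), Set.finite_range _, Set.range_nonempty _,
        Set.subset_biUnion_of_mem (u := fun x => Set.range (b x)) hxT, fun v hv => ?_,
        interior_subset hx⟩
      have h1 := (hb2 x (subset_convexHull ℝ _ hv)).2
      have h2 := (hb2 x (interior_subset hx)).2
      rw [Metric.mem_ball] at h1 h2 ⊢
      calc dist v θ ≤ dist v x + dist θ x := dist_triangle_right _ _ _
        _ < 1 / ((m : ℝ) + 1) + 1 / ((m : ℝ) + 1) := add_lt_add h1 h2
        _ = 2 / ((m : ℝ) + 1) := by ring
  choose A hA1 hA2 hA3 using key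
  refine ⟨⋃ m, A m, Set.countable_iUnion hA1, Set.iUnion_subset hA2, fun θ hθ δ hδ => ?_⟩
  obtain ⟨m, hm⟩ := exists_nat_one_div_lt (half_pos hδ)
  obtain ⟨t, h1, h2, h3, h4, h5⟩ := hA3 m θ hθ
  refine ⟨t, h1, h2, h3.trans (Set.subset_iUnion _ _),
    h4.trans (Metric.ball_subset_ball ?_), h5⟩
  have : 2 / ((m : ℝ) + 1) = 2 * (1 / ((m : ℝ) + 1)) := by ring
  linarith

/-- Pointwise convergence of convex functions on an open convex set, to a continuous limit, needs to
be checked only at the vertices of arbitrarily small simplices around each point. -/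
theorem tendsto_of_convexOn_of_simplex_vertices {Θ A : Set V} (hΘ : IsOpen Θ)
    {F : ℕ → V → ℝ} {f : V → ℝ} (hF : ∀ n, ConvexOn ℝ Θ (F n)) (hf : ContinuousOn f Θ)
    (hAΘ : A ⊆ Θ)
    (hA : ∀ θ ∈ Θ, ∀ δ > 0, ∃ t : Set V, t.Finite ∧ t.Nonempty ∧
      t ⊆ A ∧ t ⊆ Metric.ball θ δ ∧ θ ∈ convexHull ℝ t)
    (hlim : ∀ a ∈ A, Tendsto (fun n => F n a) atTop (𝓝 (f a))) :
    ∀ θ ∈ Θ, Tendsto (fun n => F n θ) atTop (𝓝 (f θ)) := by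
  have hcont : ∀ θ ∈ Θ, ∀ ε > 0, ∃ δ > 0, ∀ v, dist v θ < δ → v ∈ Θ ∧ |f v - f θ| < ε := by
    intro θ hθ ε hε
    have h1 := (hf.continuousAt (hΘ.mem_nhds hθ)).eventually (Metric.ball_mem_nhds (f θ) hε)
    obtain ⟨δ, hδ, h⟩ := Metric.eventually_nhds_iff.1 (h1.and (hΘ.mem_nhds hθ))
    exact ⟨δ, hδ, fun v hv => ⟨(h hv).2, by simpa [Real.dist_eq] using (h hv).1⟩⟩
  have upper : ∀ θ ∈ Θ, ∀ ε > 0, ∀ᶠ n in atTop, F n θ < f θ + ε := by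
    intro θ hθ ε hε
    obtain ⟨δ, hδ, h⟩ := hcont θ hθ (ε / 2) (half_pos hε)
    obtain ⟨t, ht, -, htA, htb, hθt⟩ := hA θ hθ δ hδ
    have h1 : ∀ᶠ n in atTop, ∀ v ∈ t, F n v < f v + ε / 2 :=
      (Filter.eventually_all_finite ht).2 fun v hv =>
        (hlim v (htA hv)).eventually_lt_const (by linarith)
    filter_upwards [h1] with n hn
    -- A convex function on a simplex is at most its largest vertex value, so finitely many limits
    -- give the upper bound.
    obtain ⟨v, hv, hle⟩ := (hF n).exists_ge_of_mem_convexHull (htA.trans hAΘ) hθt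
    have h2 := (abs_lt.1 (h v (htb hv)).2).2
    have h3 := hn v hv
    linarith
  intro θ hθ
  rw [Metric.tendsto_nhds]
  intro ε hε
  obtain ⟨δ, hδ, h⟩ := hcont θ hθ (ε / 8) (by positivity)
  obtain ⟨t, -, ⟨a, hat⟩, htA, htb, -⟩ := hA θ hθ (δ / 2) (half_pos hδ)
  have haθ : dist a θ < δ / 2 := htb hat
  -- Lower bound by reflection: `a` is the midpoint of `θ` and `2a - θ`, so `F n θ ≥ 2 F n a - F n
  -- (2a - θ)`, where the last term is controlled by `upper`. Reflection doubles the distance to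
  -- `θ`, hence `δ / 2`; with errors of `ε / 8` the total loss is `3ε / 4`.
  have hbθ : dist (a + (a - θ)) θ < δ := by
    have : a + (a - θ) - θ = (2 : ℝ) • (a - θ) := by rw [two_smul]; abel
    rw [dist_eq_norm, this, norm_smul, ← dist_eq_norm, Real.norm_two]
    linarith
  obtain ⟨hbΘ, hb⟩ := h _ hbθ
  obtain ⟨haΘ, ha⟩ := h a (by linarith)
  filter_upwards [upper θ hθ ε hε, upper _ hbΘ (ε / 8) (by positivity),
    (hlim a (htA hat)).eventually_const_lt (show f a - ε / 8 < f a by linarith)] with n h1 h2 h3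
  have hmid : F n a ≤ (1 / 2) * F n θ + (1 / 2) * F n (a + (a - θ)) := by
    have := (hF n).2 hθ hbΘ (show (0 : ℝ) ≤ 1 / 2 by norm_num) (show (0 : ℝ) ≤ 1 / 2 by norm_num)
      (by norm_num)
    have heq : (1 / 2 : ℝ) • θ + (1 / 2 : ℝ) • (a + (a - θ)) = a := by
      module
    rwa [heq] at this
  rw [abs_lt] at ha hb
  rw [Real.dist_eq, abs_lt]
  constructor <;> linarith

end Convex

/-! ### Log-partition function: analyticity and strict positivity of the second derivative -/

section ExpFam

variable {𝓨 : Type*} [MeasurableSpace 𝓨] {s : 𝓨 → ℝ} {ν : Measure 𝓨}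

theorem logPartition_eq_cgf : logPartition s ν = cgf s ν := rfl

/-- A nonempty natural space excludes `ν = 0`, and then the integral of a positive function is
automatically positive. This makes the theory of `mgf` and `cgf` available. -/
theorem naturalSpace_eq_integrableExpSet (h : (naturalSpace s ν).Nonempty) :
    naturalSpace s ν = integrableExpSet s ν := by
  obtain ⟨η, hη⟩ := h
  have hν : ν ≠ 0 := by
    rintro rfl
    simpa using hη.2
  exact Set.Subset.antisymm (fun _ h => h.1) fun _ h => ⟨h, mgf_pos' hν h⟩

theorem IsRegularExpFam.interior_eq (hq : IsRegularExpFam s ν) :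
    interior (integrableExpSet s ν) = naturalSpace s ν := by
  rw [← naturalSpace_eq_integrableExpSet hq.nonempty, hq.isOpen.interior_eq]

theorem IsRegularExpFam.convex (hq : IsRegularExpFam s ν) : Convex ℝ (naturalSpace s ν) := by
  rw [naturalSpace_eq_integrableExpSet hq.nonempty]
  exact convex_integrableExpSet

theorem IsRegularExpFam.analyticOnNhd (hq : IsRegularExpFam s ν) :
    AnalyticOnNhd ℝ (logPartition s ν) (naturalSpace s ν) := by
  rw [← hq.interior_eq]
  exact analyticOnNhd_cgf

/-- If `s` were constant, the factor `exp(ηm)` would cancel in the normalization and every density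
would be `1 / ν(𝓨)`. Openness supplies two distinct parameters, contradicting identifiability. -/
theorem not_ae_const (hq : IsRegularExpFam s ν) (m : ℝ) : ¬ ∀ᵐ y ∂ν, s y = m := by
  intro hm
  obtain ⟨η, hη⟩ := hq.nonempty
  obtain ⟨ε, hε, hball⟩ := Metric.isOpen_iff.1 hq.isOpen η hη
  have hη' : η + ε / 2 ∈ naturalSpace s ν := by
    apply hball
    rw [Metric.mem_ball, Real.dist_eq, add_sub_cancel_left, abs_of_pos (half_pos hε)]
    linarith
  have hdens : ∀ t ∈ naturalSpace s ν, ∀ᵐ y ∂ν,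
      ENNReal.ofReal (density s ν y t) = ENNReal.ofReal (ν.real Set.univ)⁻¹ := by
    intro t ht
    have hint : ∫ y, Real.exp (t * s y) ∂ν = ν.real Set.univ * Real.exp (t * m) := by
      rw [integral_congr_ae (g := fun _ => Real.exp (t * m))
        (hm.mono fun y hy => by simp only [hy]), integral_const, smul_eq_mul]
    filter_upwards [hm] with y hy
    rw [density, logPartition, Real.exp_sub, Real.exp_log ht.2, hint, hy]
    congr 1
    field_simp
  have := hq.identifiable hη hη' (withDensity_congr_ae
    (EventuallyEq.trans (hdens η hη) (EventuallyEq.symm (hdens _ hη'))))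
  linarith

/-- The second derivative is the variance of `s` under `Q_η`; it can vanish only if `s` is `ν`-a.e.
equal to its mean. -/
theorem IsRegularExpFam.iteratedDeriv_two_pos (hq : IsRegularExpFam s ν) {η : ℝ}
    (hη : η ∈ naturalSpace s ν) : 0 < iteratedDeriv 2 (logPartition s ν) η := by
  have hη' : η ∈ interior (integrableExpSet s ν) := hq.interior_eq ▸ hη
  rw [logPartition_eq_cgf, iteratedDeriv_two_cgf_eq_integral hη']
  refine div_pos ?_ hη.2
  set m := deriv (cgf s ν) η
  have hnn : 0 ≤ fun y => (s y - m) ^ 2 * Real.exp (η * s y) := fun y => by positivity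
  have hint : Integrable (fun y => (s y - m) ^ 2 * Real.exp (η * s y)) ν := by
    have h2 := integrable_pow_mul_exp_of_mem_interior_integrableExpSet hη' 2
    have h1 := integrable_pow_mul_exp_of_mem_interior_integrableExpSet hη' 1
    have h0 := integrable_pow_mul_exp_of_mem_interior_integrableExpSet hη' 0
    refine ((h2.sub (h1.const_mul (2 * m))).add (h0.const_mul (m ^ 2))).congr
      (.of_forall fun y => ?_)
    simp only [Pi.add_apply, Pi.sub_apply]
    ring
  refine lt_of_le_of_ne (integral_nonneg hnn) fun h0 => not_ae_const hq m ?_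
  have := (integral_eq_zero_iff_of_nonneg hnn hint).1 h0.symm
  filter_upwards [this] with y hy
  have h1 := (mul_eq_zero.1 hy).resolve_right (Real.exp_ne_zero _)
  exact sub_eq_zero.1 (pow_eq_zero_iff two_ne_zero |>.1 h1)

theorem hasDerivAt_iteratedDeriv {κ : ℝ → ℝ} {N : Set ℝ} (hκ : AnalyticOnNhd ℝ κ N)
    (n : ℕ) {t : ℝ} (ht : t ∈ N) :
    HasDerivAt (iteratedDeriv n κ) (iteratedDeriv (n + 1) κ t) t := by
  rw [iteratedDeriv_succ, iteratedDeriv_eq_iterate]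
  exact (hκ.iterated_deriv n t ht).differentiableAt.hasDerivAt

theorem IsRegularExpFam.convexOn (hq : IsRegularExpFam s ν) :
    ConvexOn ℝ (naturalSpace s ν) (logPartition s ν) := by
  refine convexOn_of_deriv2_nonneg hq.convex hq.analyticOnNhd.continuousOn ?_ ?_ ?_
  · exact fun t ht => (hq.analyticOnNhd t (interior_subset ht)).differentiableAt
      |>.differentiableWithinAt
  · exact fun t ht => (hq.analyticOnNhd.deriv t (interior_subset ht)).differentiableAt
      |>.differentiableWithinAt
  · intro t ht
    rw [← iteratedDeriv_eq_iterate]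
    exact (hq.iteratedDeriv_two_pos (interior_subset ht)).le

theorem measurable_logPartition [SFinite ν] (hs : Measurable s) :
    Measurable (logPartition s ν) := by
  refine Real.measurable_log.comp (StronglyMeasurable.measurable ?_)
  exact StronglyMeasurable.integral_prod_right' (f := fun p : ℝ × 𝓨 => Real.exp (p.1 * s p.2))
    (Real.measurable_exp.comp (measurable_fst.mul (hs.comp measurable_snd))).stronglyMeasurable

theorem log_density (s : 𝓨 → ℝ) (ν : Measure 𝓨) (y : 𝓨) (η : ℝ) :
    Real.log (density s ν y η) = η * s y - logPartition s ν η := Real.log_exp _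

end ExpFam


/-! ### Bounds on lower derivatives in one variable -/

section OneDim

variable {κ : ℝ → ℝ} {N : Set ℝ}

/-- The tangent at `a` lies below the graph; evaluating it at `a + b` and `a - b` bounds `κ'(a) b`
from both sides. Integrability of `κ` thereby passes to the first derivative. -/
theorem abs_deriv_mul_le_of_convexOn (hκ : AnalyticOnNhd ℝ κ N) (hc : ConvexOn ℝ N κ) {a b : ℝ}
    (ha : a ∈ N) (hp : a + b ∈ N) (hm : a - b ∈ N) :
    |iteratedDeriv 1 κ a * b| ≤ |κ (a + b)| + |κ (a - b)| + |κ a| := by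
  have key : ∀ u, a + u ∈ N → iteratedDeriv 1 κ a * u ≤ κ (a + u) - κ a := by
    intro u hu
    have hd : HasDerivAt κ (iteratedDeriv 1 κ a) a := by
      simpa using hasDerivAt_iteratedDeriv hκ 0 ha
    rcases lt_trichotomy u 0 with h | rfl | h
    · have := hc.slope_le_of_hasDerivAt hu ha (by linarith) hd
      rw [slope_def_field, div_le_iff₀ (by linarith)] at this
      linarith
    · simp
    · have := hc.le_slope_of_hasDerivAt ha hu (by linarith) hd
      rw [slope_def_field, le_div_iff₀ (by linarith)] at this
      linarith
  have h1 := key b hp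
  have h2 := key (-b) (by rwa [← sub_eq_add_neg])
  rw [← sub_eq_add_neg] at h2
  rw [abs_le]
  have := neg_abs_le (κ (a + b))
  have := le_abs_self (κ (a + b))
  have := neg_abs_le (κ (a - b))
  have := le_abs_self (κ (a - b))
  have := neg_abs_le (κ a)
  have := abs_nonneg (κ (a + b))
  have := abs_nonneg (κ (a - b))
  constructor <;> nlinarith

/-- The mean value theorem for `t ↦ κ'(a + tb) b` produces a `ξ` where `κ''(a + ξb) b²` equals the
increment of this function over `[0, 1]`. Moving from `ξ` back to `0` costs at most `M`. -/
theorem abs_iteratedDeriv_two_mul_sq_le (hκ : AnalyticOnNhd ℝ κ N) {a b M : ℝ}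
    (hN : ∀ t ∈ Set.Icc (0 : ℝ) 1, a + t * b ∈ N)
    (hM : ∀ t ∈ Set.Icc (0 : ℝ) 1, |iteratedDeriv 3 κ (a + t * b) * b ^ 3| ≤ M) :
    |iteratedDeriv 2 κ a * b ^ 2| ≤
      |iteratedDeriv 1 κ (a + b) * b| + |iteratedDeriv 1 κ a * b| + M := by
  have hline : ∀ t : ℝ, HasDerivAt (fun t : ℝ => a + t * b) b t := fun t => by
    simpa using ((hasDerivAt_id t).mul_const b).const_add a
  have h1 : ∀ t ∈ Set.Icc (0 : ℝ) 1, HasDerivAt (fun t => iteratedDeriv 1 κ (a + t * b) * b)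
      (iteratedDeriv 2 κ (a + t * b) * b ^ 2) t := fun t ht => by
    have := ((hasDerivAt_iteratedDeriv hκ 1 (hN t ht)).comp t (hline t)).mul_const b
    exact this.congr_deriv (by ring)
  have h2 : ∀ t ∈ Set.Icc (0 : ℝ) 1, HasDerivAt (fun t => iteratedDeriv 2 κ (a + t * b) * b ^ 2)
      (iteratedDeriv 3 κ (a + t * b) * b ^ 3) t := fun t ht => by
    have := ((hasDerivAt_iteratedDeriv hκ 2 (hN t ht)).comp t (hline t)).mul_const (b ^ 2)
    exact this.congr_deriv (by ring)
  obtain ⟨ξ, hξ, hslope⟩ := exists_hasDerivAt_eq_slope _ _ zero_lt_one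
    (fun t ht => (h1 t ht).continuousAt.continuousWithinAt)
    (fun t ht => h1 t (Set.Ioo_subset_Icc_self ht))
  have hξ' := Set.Ioo_subset_Icc_self hξ
  have h3 := (convex_Icc (0 : ℝ) 1).norm_image_sub_le_of_norm_hasDerivWithin_le
    (fun t ht => (h2 t ht).hasDerivWithinAt) (C := M) (fun t ht => hM t ht)
    (Set.left_mem_Icc.2 zero_le_one) hξ'
  have hM0 : 0 ≤ M := (abs_nonneg _).trans (hM 0 (Set.left_mem_Icc.2 zero_le_one))
  simp only [zero_mul, add_zero, one_mul, sub_zero, div_one, Real.norm_eq_abs] at h3 hslope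
  have h4 : M * |ξ| ≤ M := by
    rw [abs_of_nonneg hξ'.1]
    exact mul_le_of_le_one_right hM0 hξ'.2
  rw [hslope] at h3
  set u := iteratedDeriv 1 κ (a + b) * b
  set v := iteratedDeriv 1 κ a * b
  set w := iteratedDeriv 2 κ a * b ^ 2
  have h5 := abs_sub_abs_le_abs_sub w (u - v)
  rw [abs_sub_comm w] at h5
  have h6 := abs_sub u v
  linarith

end OneDim

/-! ### Calculus of ridge functions and their expectations -/

section Ridge

variable {V : Type*} [NormedAddCommGroup V] [InnerProductSpace ℝ V]

/-- The derivative of a ridge function `θ ↦ g ⟨θ, x⟩`. -/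
theorem hasFDerivAt_ridge {g : ℝ → ℝ} {g' : ℝ} {θ x : V}
    (h : HasDerivAt g g' (inner ℝ θ x)) :
    HasFDerivAt (fun θ : V => g (inner ℝ θ x)) (g' • innerSL ℝ x) θ := by
  have hin : HasFDerivAt (fun θ : V => inner ℝ θ x) (innerSL ℝ x) θ := by
    simpa [real_inner_comm] using (innerSL ℝ x).hasFDerivAt (x := θ)
  exact h.comp_hasFDerivAt θ hin

/-- Mean value inequality on the ball, as the gradient has norm `|g'| ‖x‖`. It turns a uniform bound
on one derivative into a uniform bound on the preceding one, given its value at the centre. -/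
theorem abs_ridge_le_of_deriv_le {g g' : ℝ → ℝ} {N : Set ℝ} {x θ₀ : V} {ρ C : ℝ}
    (hg : ∀ t ∈ N, HasDerivAt g (g' t) t)
    (hN : ∀ θ ∈ Metric.ball θ₀ ρ, inner ℝ θ x ∈ N)
    (hC : ∀ θ ∈ Metric.ball θ₀ ρ, |g' (inner ℝ θ x)| * ‖x‖ ≤ C) {θ : V}
    (hθ : θ ∈ Metric.ball θ₀ ρ) :
    |g (inner ℝ θ x)| ≤ |g (inner ℝ θ₀ x)| + C * ρ := by
  have hρ : 0 < ρ := dist_nonneg.trans_lt hθ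
  have hθ₀ : θ₀ ∈ Metric.ball θ₀ ρ := Metric.mem_ball_self hρ
  have h := (convex_ball θ₀ ρ).norm_image_sub_le_of_norm_hasFDerivWithin_le
    (f := fun θ : V => g (inner ℝ θ x)) (C := C)
    (fun θ hθ => (hasFDerivAt_ridge (hg _ (hN θ hθ))).hasFDerivWithinAt)
    (fun θ hθ => by rw [norm_smul, innerSL_apply_norm]; exact hC θ hθ) hθ₀ hθ
  have hC0 : 0 ≤ C := (by positivity : (0 : ℝ) ≤ _).trans (hC θ₀ hθ₀)
  have h1 : C * ‖θ - θ₀‖ ≤ C * ρ := by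
    gcongr
    exact (mem_ball_iff_norm.1 hθ).le
  have h2 := abs_sub_abs_le_abs_sub (g (inner ℝ θ x)) (g (inner ℝ θ₀ x))
  rw [Real.norm_eq_abs] at h
  linarith

/-- The norm of an iterated derivative of a ridge function. -/
theorem norm_iteratedFDeriv_ridge_le {g : ℝ → ℝ} {N : Set ℝ} (hN : IsOpen N) {n : ℕ}
    (hg : ContDiffOn ℝ n g N) {θ x : V} (hθ : inner ℝ θ x ∈ N) :
    ‖iteratedFDeriv ℝ n (fun θ : V => g (inner ℝ θ x)) θ‖ ≤
      |iteratedDeriv n g (inner ℝ θ x)| * ‖x‖ ^ n := by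
  have hfun : (fun θ : V => g (inner ℝ θ x)) = g ∘ innerSL ℝ x := by
    ext θ; simp [real_inner_comm]
  have hin : inner ℝ θ x = innerSL ℝ x θ := by simp [real_inner_comm]
  have hpre : IsOpen (innerSL ℝ x ⁻¹' N) := hN.preimage (innerSL ℝ x).continuous
  rw [hin] at hθ ⊢
  rw [hfun, ← iteratedFDerivWithin_of_isOpen n hpre hθ,
    (innerSL ℝ x).iteratedFDerivWithin_comp_right hg hN.uniqueDiffOn hpre.uniqueDiffOn hθ le_rfl]
  refine (ContinuousMultilinearMap.norm_compContinuousLinearMap_le _ _).trans ?_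
  rw [iteratedFDerivWithin_of_isOpen n hN hθ, norm_iteratedFDeriv_eq_norm_iteratedDeriv]
  simp [Real.norm_eq_abs, innerSL_apply_norm]

variable {Ω : Type*} [MeasurableSpace Ω] {P : Measure Ω} {Z : Ω → V}
  {G : Type*} [NormedAddCommGroup G] [NormedSpace ℝ G]

/-- Differentiation under the integral sign for ridge functions. -/
theorem hasFDerivAt_integral_ridge {g g' : ℝ → ℝ} {N : Set ℝ} {W : Ω → G} {bound : Ω → ℝ}
    {S : Set V} {θ₀ : V} (hS : S ∈ 𝓝 θ₀)
    (hg : ∀ t ∈ N, HasDerivAt g (g' t) t)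
    (hN : ∀ θ ∈ S, ∀ ω, inner ℝ θ (Z ω) ∈ N)
    (hgm : Measurable g) (hgm' : Measurable g')
    (hZ : AEStronglyMeasurable Z P) (hW : AEStronglyMeasurable W P)
    (hint : Integrable (fun ω => g (inner ℝ θ₀ (Z ω)) • W ω) P)
    (hbound : ∀ᵐ ω ∂P, ∀ θ ∈ S, |g' (inner ℝ θ (Z ω))| * ‖Z ω‖ * ‖W ω‖ ≤ bound ω)
    (hbint : Integrable bound P) :
    HasFDerivAt (fun θ => ∫ ω, g (inner ℝ θ (Z ω)) • W ω ∂P)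
      (∫ ω, g' (inner ℝ θ₀ (Z ω)) • (innerSL ℝ (Z ω)).smulRight (W ω) ∂P) θ₀ := by
  have hin : ∀ θ : V, AEMeasurable (fun ω => inner ℝ θ (Z ω)) P := fun θ =>
    (aestronglyMeasurable_const.inner hZ).aemeasurable
  have hsmul : AEStronglyMeasurable (fun ω => (innerSL ℝ (Z ω)).smulRight (W ω)) P := by
    have hc : Continuous fun p : (V →L[ℝ] ℝ) × G => p.1.smulRight p.2 :=
      ((ContinuousLinearMap.smulRightL ℝ V G).continuous₂)
    exact hc.comp_aestronglyMeasurable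
      (((innerSL ℝ (E := V)).continuous.comp_aestronglyMeasurable hZ).prodMk hW)
  refine hasFDerivAt_integral_of_dominated_of_fderiv_le hS
    (F' := fun θ ω => g' (inner ℝ θ (Z ω)) • (innerSL ℝ (Z ω)).smulRight (W ω))
    (.of_forall fun θ => ((hgm.comp_aemeasurable (hin θ)).aestronglyMeasurable).smul hW) hint
    (((hgm'.comp_aemeasurable (hin θ₀)).aestronglyMeasurable).smul hsmul) ?_ hbint ?_
  · filter_upwards [hbound] with ω hω θ hθ
    rw [norm_smul, ContinuousLinearMap.norm_smulRight_apply, innerSL_apply_norm, ← mul_assoc]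
    exact hω θ hθ
  · refine .of_forall fun ω θ hθ => ?_
    have := (hasFDerivAt_ridge (hg _ (hN θ hθ ω))).smul_const (W ω)
    refine this.congr_fderiv ?_
    ext v
    simp [smul_smul]

end Ridge


open scoped ENNReal

/-! ### From coordinatewise third moments to a measurable norm bound -/

section Coordinates

variable {D : ℕ}

theorem norm_le_sum_abs_coord (x : EuclideanSpace ℝ (Fin D)) : ‖x‖ ≤ ∑ j, |x j| := by
  rw [EuclideanSpace.norm_eq, Real.sqrt_le_left (Finset.sum_nonneg fun _ _ => abs_nonneg _)]
  exact Finset.sum_sq_le_sq_sum_of_nonneg fun _ _ => abs_nonneg _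

theorem abs_mul_norm_pow_three_le (a : ℝ) (x : EuclideanSpace ℝ (Fin D)) :
    |a| * ‖x‖ ^ 3 ≤ ∑ j, ∑ k, ∑ l, |a * x j * x k * x l| := by
  calc |a| * ‖x‖ ^ 3 ≤ |a| * (∑ j, |x j|) ^ 3 := by
        gcongr
        exact norm_le_sum_abs_coord x
    _ = ∑ j, ∑ k, ∑ l, |a * x j * x k * x l| := by
        simp only [abs_mul, ← Finset.mul_sum, ← Finset.sum_mul]
        ring

/-- The supremum over a ball in the third moment condition is dominated by a measurable function of
the covariate with the same integrability. -/
theorem exists_measurable_third_bound {g : ℝ → ℝ} {N : Set ℝ} (hNo : IsOpen N)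
    (hg : ContinuousOn g N) (hgm : Measurable g) {𝓧 B : Set (EuclideanSpace ℝ (Fin D))}
    (hB : ∀ θ ∈ B, ∀ x ∈ 𝓧, inner ℝ θ x ∈ N)
    {Ω : Type*} [MeasurableSpace Ω] {P : Measure Ω} {Z : Ω → EuclideanSpace ℝ (Fin D)}
    (hZ : Measurable Z)
    (h_third : ∀ j k l : Fin D, ∫⁻ ω, ⨆ θ ∈ closure B,
      ‖g (inner ℝ θ (Z ω)) * Z ω j * Z ω k * Z ω l‖ₑ ∂P < ⊤) :
    ∃ M : EuclideanSpace ℝ (Fin D) → ℝ≥0∞, Measurable M ∧ ∫⁻ ω, M (Z ω) ∂P < ⊤ ∧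
      ∀ x ∈ 𝓧, M x ≠ ⊤ → ∀ θ ∈ B, |g (inner ℝ θ x)| * ‖x‖ ^ 3 ≤ (M x).toReal := by
  -- A supremum over a countable dense subset is measurable in `x`; continuity in `θ` recovers the
  -- bound on all of `B`.
  obtain ⟨S, hSB, hSc, hSd⟩ :=
    (TopologicalSpace.IsSeparable.of_separableSpace B).exists_countable_dense_subset
  set m : Fin D → Fin D → Fin D → EuclideanSpace ℝ (Fin D) → ℝ≥0∞ := fun j k l x =>
    ⨆ θ ∈ S, ‖g (inner ℝ θ x) * x j * x k * x l‖ₑ with hm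
  have hmm : ∀ j k l, Measurable (m j k l) := fun j k l => by
    refine Measurable.biSup S hSc fun θ _ => ?_
    have h1 : ∀ i : Fin D, Measurable fun x : EuclideanSpace ℝ (Fin D) => x i := fun i => by
      fun_prop
    have h2 : Measurable fun x : EuclideanSpace ℝ (Fin D) => g (inner ℝ θ x) :=
      hgm.comp (by fun_prop)
    exact (((h2.mul (h1 j)).mul (h1 k)).mul (h1 l)).enorm
  refine ⟨fun x => ∑ j, ∑ k, ∑ l, m j k l x, ?_, ?_, ?_⟩
  · exact Finset.measurable_sum _ fun j _ => Finset.measurable_sum _ fun k _ =>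
      Finset.measurable_sum _ fun l _ => hmm j k l
  · have hmZ : ∀ j k l, Measurable fun ω => m j k l (Z ω) := fun j k l => (hmm j k l).comp hZ
    rw [lintegral_finsetSum _ fun j _ => Finset.measurable_sum _ fun k _ =>
      Finset.measurable_sum _ fun l _ => hmZ j k l]
    refine ENNReal.sum_lt_top.2 fun j _ => ?_
    rw [lintegral_finsetSum _ fun k _ => Finset.measurable_sum _ fun l _ => hmZ j k l]
    refine ENNReal.sum_lt_top.2 fun k _ => ?_
    rw [lintegral_finsetSum _ fun l _ => hmZ j k l]
    refine ENNReal.sum_lt_top.2 fun l _ => (lintegral_mono fun ω => ?_).trans_lt (h_third j k l)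
    exact biSup_mono fun θ hθ => subset_closure (hSB hθ)
  · intro x hx hMx θ hθ
    have hle : ∀ j k l, ‖g (inner ℝ θ x) * x j * x k * x l‖ₑ ≤ m j k l x := by
      intro j k l
      have hne : (𝓝[S] θ).NeBot := mem_closure_iff_nhdsWithin_neBot.1 (hSd hθ)
      have hin : Continuous fun θ : EuclideanSpace ℝ (Fin D) => inner ℝ θ x := by fun_prop
      have hcont : ContinuousAt
          (fun θ : EuclideanSpace ℝ (Fin D) => ‖g (inner ℝ θ x) * x j * x k * x l‖ₑ) θ := by
        have : ContinuousAt (fun θ : EuclideanSpace ℝ (Fin D) => g (inner ℝ θ x)) θ :=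
          ContinuousAt.comp (g := g) (f := fun θ : EuclideanSpace ℝ (Fin D) => inner ℝ θ x)
            (hg.continuousAt (hNo.mem_nhds (hB θ hθ x hx))) hin.continuousAt
        exact continuous_enorm.continuousAt.comp
          (((this.mul continuousAt_const).mul continuousAt_const).mul continuousAt_const)
      refine le_of_tendsto (x := 𝓝[S] θ) (hcont.tendsto.mono_left nhdsWithin_le_nhds) ?_
      filter_upwards [self_mem_nhdsWithin] with θ' hθ'
      exact le_iSup₂ (f := fun θ _ => ‖g (inner ℝ θ x) * x j * x k * x l‖ₑ) θ' hθ'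
    refine (abs_mul_norm_pow_three_le _ x).trans ?_
    rw [← ENNReal.ofReal_le_iff_le_toReal hMx,
      ENNReal.ofReal_sum_of_nonneg fun j _ => Finset.sum_nonneg fun k _ =>
        Finset.sum_nonneg fun l _ => abs_nonneg _]
    refine Finset.sum_le_sum fun j _ => ?_
    rw [ENNReal.ofReal_sum_of_nonneg fun k _ => Finset.sum_nonneg fun l _ => abs_nonneg _]
    refine Finset.sum_le_sum fun k _ => ?_
    rw [ENNReal.ofReal_sum_of_nonneg fun l _ => abs_nonneg _]
    refine Finset.sum_le_sum fun l _ => ?_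
    rw [← Real.norm_eq_abs, ofReal_norm]
    exact hle j k l

end Coordinates

/-! ### Integrability of lower derivatives and differentiation under the expectation -/

theorem exists_pos_segment_subset {V : Type*} [NormedAddCommGroup V] [NormedSpace ℝ V]
    {Θ : Set V} (hΘ : IsOpen Θ) {θ : V} (hθ : θ ∈ Θ) (v : V) :
    ∃ t > 0, ∀ u : ℝ, |u| ≤ t → θ + u • v ∈ Θ := by
  obtain ⟨ε, hε, hb⟩ := Metric.isOpen_iff.1 hΘ θ hθ
  refine ⟨ε / (‖v‖ + 1), by positivity, fun u hu => hb ?_⟩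
  rw [mem_ball_iff_norm, add_sub_cancel_left, norm_smul, Real.norm_eq_abs]
  calc |u| * ‖v‖ ≤ ε / (‖v‖ + 1) * ‖v‖ := by gcongr
    _ < ε / (‖v‖ + 1) * (‖v‖ + 1) := by
        gcongr
        linarith
    _ = ε := by field_simp

section Integrability

variable {D : ℕ} {κ : ℝ → ℝ} {N : Set ℝ} {Θ B : Set (EuclideanSpace ℝ (Fin D))}
  {Ω : Type*} [MeasurableSpace Ω] {P : Measure Ω} {Z : Ω → EuclideanSpace ℝ (Fin D)}

theorem measurable_iteratedDeriv_succ (κ : ℝ → ℝ) (n : ℕ) :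
    Measurable (iteratedDeriv (n + 1) κ) := by
  rw [iteratedDeriv_succ]
  exact measurable_deriv _

theorem measurable_iteratedDeriv_inner (hZ : Measurable Z) (κ : ℝ → ℝ) (n : ℕ)
    (θ : EuclideanSpace ℝ (Fin D)) :
    Measurable fun ω => iteratedDeriv (n + 1) κ (inner ℝ θ (Z ω)) :=
  (measurable_iteratedDeriv_succ κ n).comp (measurable_const.inner hZ)

/-- Openness of `Θ` leaves room for `θ ± tv`, and the tangent bound with `b = t vᵀZ` dominates the
integrand by three integrable values of `κ`. -/
theorem integrable_deriv_mul_inner (hκ : AnalyticOnNhd ℝ κ N) (hc : ConvexOn ℝ N κ)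
    (hZ : Measurable Z) (hΘ : IsOpen Θ) (hN : ∀ θ ∈ Θ, ∀ ω, inner ℝ θ (Z ω) ∈ N)
    (hint : ∀ θ ∈ Θ, Integrable (fun ω => κ (inner ℝ θ (Z ω))) P)
    {θ : EuclideanSpace ℝ (Fin D)} (hθ : θ ∈ Θ) (v : EuclideanSpace ℝ (Fin D)) :
    Integrable (fun ω => iteratedDeriv 1 κ (inner ℝ θ (Z ω)) * inner ℝ v (Z ω)) P := by
  obtain ⟨t, ht, hseg⟩ := exists_pos_segment_subset hΘ hθ v
  have hp : θ + t • v ∈ Θ := hseg t (abs_of_pos ht).le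
  have hm : θ + (-t) • v ∈ Θ := hseg (-t) (by rw [abs_neg, abs_of_pos ht])
  refine Integrable.mono' ((((hint _ hp).abs.add (hint _ hm).abs).add (hint θ hθ).abs).const_mul
    t⁻¹) ((measurable_iteratedDeriv_inner hZ κ 0 θ).mul
      (measurable_const.inner hZ)).aestronglyMeasurable (.of_forall fun ω => ?_)
  have h1 := hN _ hp ω
  have h2 := hN _ hm ω
  have e1 : inner ℝ (θ + t • v) (Z ω) = inner ℝ θ (Z ω) + t * inner ℝ v (Z ω) := by
    rw [inner_add_left, real_inner_smul_left]
  have e2 : inner ℝ (θ + (-t) • v) (Z ω) = inner ℝ θ (Z ω) - t * inner ℝ v (Z ω) := by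
    rw [inner_add_left, real_inner_smul_left]; ring
  have := abs_deriv_mul_le_of_convexOn hκ hc (hN θ hθ ω) (e1 ▸ h1) (e2 ▸ h2)
  simp only [Pi.add_apply, e1, e2]
  rw [Real.norm_eq_abs, le_inv_mul_iff₀ ht]
  refine le_trans (le_of_eq ?_) this
  rw [mul_left_comm, abs_mul t, abs_of_pos ht]

theorem integrable_deriv_mul_norm (hκ : AnalyticOnNhd ℝ κ N) (hc : ConvexOn ℝ N κ)
    (hZ : Measurable Z) (hΘ : IsOpen Θ) (hN : ∀ θ ∈ Θ, ∀ ω, inner ℝ θ (Z ω) ∈ N)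
    (hint : ∀ θ ∈ Θ, Integrable (fun ω => κ (inner ℝ θ (Z ω))) P)
    {θ : EuclideanSpace ℝ (Fin D)} (hθ : θ ∈ Θ) :
    Integrable (fun ω => |iteratedDeriv 1 κ (inner ℝ θ (Z ω))| * ‖Z ω‖) P := by
  refine Integrable.mono' (integrable_finsetSum Finset.univ fun j _ =>
    (integrable_deriv_mul_inner hκ hc hZ hΘ hN hint hθ (EuclideanSpace.single j 1)).abs)
    ((measurable_iteratedDeriv_inner hZ κ 0 θ).abs.mul hZ.norm).aestronglyMeasurable
    (.of_forall fun ω => ?_)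
  rw [Real.norm_eq_abs, abs_of_nonneg (by positivity)]
  simp only [abs_mul, ← Finset.mul_sum, EuclideanSpace.inner_single_left, map_one, one_mul]
  gcongr
  exact norm_le_sum_abs_coord _

/-- Along each coordinate direction, the one-variable bound dominates the second derivative by first
derivatives, already integrable, and by `M`. Summing the squared coordinates gives the norm. -/
theorem integrable_iteratedDeriv_two_mul_norm_sq (hκ : AnalyticOnNhd ℝ κ N)
    (hc : ConvexOn ℝ N κ) (hZ : Measurable Z) (hΘ : IsOpen Θ)
    (hN : ∀ θ ∈ Θ, ∀ ω, inner ℝ θ (Z ω) ∈ N)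
    (hint : ∀ θ ∈ Θ, Integrable (fun ω => κ (inner ℝ θ (Z ω))) P)
    (hB : IsOpen B) (hBΘ : B ⊆ Θ) {M : Ω → ℝ} (hMint : Integrable M P)
    (hM : ∀ᵐ ω ∂P, ∀ θ ∈ B, |iteratedDeriv 3 κ (inner ℝ θ (Z ω))| * ‖Z ω‖ ^ 3 ≤ M ω)
    {θ : EuclideanSpace ℝ (Fin D)} (hθ : θ ∈ B) :
    Integrable (fun ω => |iteratedDeriv 2 κ (inner ℝ θ (Z ω))| * ‖Z ω‖ ^ 2) P := by
  have hcoord : ∀ j : Fin D, Integrable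
      (fun ω => iteratedDeriv 2 κ (inner ℝ θ (Z ω)) * (Z ω j) ^ 2) P := by
    intro j
    set e : EuclideanSpace ℝ (Fin D) := EuclideanSpace.single j 1 with he
    have hej : ∀ x : EuclideanSpace ℝ (Fin D), inner ℝ e x = x j := fun x => by
      simp [he, EuclideanSpace.inner_single_left]
    obtain ⟨t, ht, hseg⟩ := exists_pos_segment_subset hB hθ e
    have hp : θ + t • e ∈ Θ := hBΘ (hseg t (abs_of_pos ht).le)
    have i1 := (integrable_deriv_mul_inner hκ hc hZ hΘ hN hint hp (t • e)).abs
    have i2 := (integrable_deriv_mul_inner hκ hc hZ hΘ hN hint (hBΘ hθ) (t • e)).abs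
    have hmeas : Measurable fun ω => iteratedDeriv 2 κ (inner ℝ θ (Z ω)) * (Z ω j) ^ 2 := by
      have : Measurable fun ω => Z ω j := by fun_prop
      exact (measurable_iteratedDeriv_inner hZ κ 1 θ).mul (this.pow_const 2)
    refine Integrable.mono' (((i1.add i2).add (hMint.const_mul (t ^ 3))).const_mul (t ^ 2)⁻¹)
      hmeas.aestronglyMeasurable ?_
    filter_upwards [hM] with ω hω
    have hin : ∀ u : ℝ, inner ℝ (θ + (u * t) • e) (Z ω) =
        inner ℝ θ (Z ω) + u * (t * Z ω j) := fun u => by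
      rw [inner_add_left, real_inner_smul_left, hej, mul_assoc]
    have hmem : ∀ u ∈ Set.Icc (0 : ℝ) 1, θ + (u * t) • e ∈ B := fun u hu => hseg _ <| by
      rw [abs_of_nonneg (mul_nonneg hu.1 ht.le)]
      exact mul_le_of_le_one_left ht.le hu.2
    have hx : |Z ω j| ≤ ‖Z ω‖ := by
      simpa [Real.norm_eq_abs] using PiLp.norm_apply_le (Z ω) j
    have := abs_iteratedDeriv_two_mul_sq_le hκ (a := inner ℝ θ (Z ω)) (b := t * Z ω j)
      (M := t ^ 3 * M ω) (fun u hu => hin u ▸ hN _ (hBΘ (hmem u hu)) ω) (fun u hu => by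
        rw [← hin u, mul_pow, mul_left_comm, abs_mul, abs_of_pos (pow_pos ht 3)]
        gcongr
        refine le_trans ?_ (hω _ (hmem u hu))
        rw [abs_mul, abs_pow]
        gcongr)
    have e1 : inner ℝ (θ + t • e) (Z ω) = inner ℝ θ (Z ω) + t * Z ω j := by
      simpa using hin 1
    rw [Real.norm_eq_abs, le_inv_mul_iff₀ (by positivity)]
    simp only [Pi.add_apply, e1, real_inner_smul_left, hej]
    refine le_trans (le_of_eq ?_) this
    rw [mul_pow, mul_left_comm, abs_mul (t ^ 2), abs_of_pos (pow_pos ht 2)]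
  refine (integrable_finsetSum Finset.univ fun j _ => (hcoord j).abs).congr
    (.of_forall fun ω => ?_)
  simp only [abs_mul, ← Finset.mul_sum, EuclideanSpace.norm_sq_eq, abs_pow, Real.norm_eq_abs]

/-- The expectation of a convex ridge function is twice differentiable where the third derivative is
locally dominated. -/
theorem hasFDerivAt_fderiv_integral_ridge (hκ : AnalyticOnNhd ℝ κ N)
    (hc : ConvexOn ℝ N κ) (hκm : Measurable κ) (hZ : Measurable Z) (hΘ : IsOpen Θ)
    (hN : ∀ θ ∈ Θ, ∀ ω, inner ℝ θ (Z ω) ∈ N)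
    (hint : ∀ θ ∈ Θ, Integrable (fun ω => κ (inner ℝ θ (Z ω))) P)
    (hB : IsOpen B) (hBΘ : B ⊆ Θ) {M : Ω → ℝ} (hMint : Integrable M P)
    (hM : ∀ᵐ ω ∂P, ∀ θ ∈ B, |iteratedDeriv 3 κ (inner ℝ θ (Z ω))| * ‖Z ω‖ ^ 3 ≤ M ω)
    {θ₀ : EuclideanSpace ℝ (Fin D)} (hθ₀ : θ₀ ∈ B) :
    (∀ᶠ θ in 𝓝 θ₀, HasFDerivAt (fun θ => ∫ ω, κ (inner ℝ θ (Z ω)) ∂P)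
      (∫ ω, iteratedDeriv 1 κ (inner ℝ θ (Z ω)) • innerSL ℝ (Z ω) ∂P) θ) ∧
    HasFDerivAt (fun θ => ∫ ω, iteratedDeriv 1 κ (inner ℝ θ (Z ω)) • innerSL ℝ (Z ω) ∂P)
      (∫ ω, iteratedDeriv 2 κ (inner ℝ θ₀ (Z ω)) •
        (innerSL ℝ (Z ω)).smulRight (innerSL ℝ (Z ω)) ∂P) θ₀ := by
  obtain ⟨ρ, hρ, hball⟩ := Metric.isOpen_iff.1 hB θ₀ hθ₀
  have hballN : ∀ θ ∈ Metric.ball θ₀ ρ, ∀ ω, inner ℝ θ (Z ω) ∈ N := fun θ hθ =>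
    hN θ (hBΘ (hball hθ))
  have hd : ∀ n, ∀ t ∈ N, HasDerivAt (iteratedDeriv n κ) (iteratedDeriv (n + 1) κ t) t :=
    fun n t ht => hasDerivAt_iteratedDeriv hκ n ht
  -- Dominating functions on the whole ball, obtained by descending from the third derivative: value
  -- at `θ₀` plus radius times the bound one order higher.
  set b2 : Ω → ℝ := fun ω => |iteratedDeriv 2 κ (inner ℝ θ₀ (Z ω))| * ‖Z ω‖ ^ 2 + M ω * ρ with hb2
  set b1 : Ω → ℝ := fun ω => |iteratedDeriv 1 κ (inner ℝ θ₀ (Z ω))| * ‖Z ω‖ + b2 ω * ρ with hb1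
  have hb2int : Integrable b2 P := (integrable_iteratedDeriv_two_mul_norm_sq hκ hc hZ hΘ hN hint
    hB hBΘ hMint hM hθ₀).add (hMint.mul_const ρ)
  have hb1int : Integrable b1 P := (integrable_deriv_mul_norm hκ hc hZ hΘ hN hint
    (hBΘ hθ₀)).add (hb2int.mul_const ρ)
  have h2 : ∀ᵐ ω ∂P, ∀ θ ∈ Metric.ball θ₀ ρ,
      |iteratedDeriv 2 κ (inner ℝ θ (Z ω))| * ‖Z ω‖ ^ 2 ≤ b2 ω := by
    filter_upwards [hM] with ω hω θ hθ
    have := abs_ridge_le_of_deriv_le (g := fun t => iteratedDeriv 2 κ t * ‖Z ω‖ ^ 2)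
      (g' := fun t => iteratedDeriv 3 κ t * ‖Z ω‖ ^ 2) (x := Z ω) (C := M ω)
      (fun t ht => (hd 2 t ht).mul_const _) (fun θ hθ => hballN θ hθ ω) (fun θ hθ => by
        refine le_trans (le_of_eq ?_) (hω θ (hball hθ))
        rw [abs_mul, abs_of_nonneg (sq_nonneg ‖Z ω‖)]
        ring) hθ
    simpa only [abs_mul, abs_of_nonneg (sq_nonneg ‖Z ω‖)] using this
  have h1 : ∀ᵐ ω ∂P, ∀ θ ∈ Metric.ball θ₀ ρ,
      |iteratedDeriv 1 κ (inner ℝ θ (Z ω))| * ‖Z ω‖ ≤ b1 ω := by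
    filter_upwards [h2] with ω hω θ hθ
    have := abs_ridge_le_of_deriv_le (g := fun t => iteratedDeriv 1 κ t * ‖Z ω‖)
      (g' := fun t => iteratedDeriv 2 κ t * ‖Z ω‖) (x := Z ω) (C := b2 ω)
      (fun t ht => (hd 1 t ht).mul_const _) (fun θ hθ => hballN θ hθ ω) (fun θ hθ => by
        refine le_trans (le_of_eq ?_) (hω θ hθ)
        rw [abs_mul, abs_norm]
        ring) hθ
    simpa only [abs_mul, abs_norm] using this
  constructor
  · filter_upwards [Metric.ball_mem_nhds θ₀ hρ] with θ hθ
    have := hasFDerivAt_integral_ridge (g := κ) (g' := iteratedDeriv 1 κ) (W := fun _ => (1 : ℝ))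
      (Metric.isOpen_ball.mem_nhds hθ) (by simpa using hd 0) hballN hκm
      (measurable_iteratedDeriv_succ κ 0) hZ.aestronglyMeasurable aestronglyMeasurable_const
      (by simpa using hint θ (hBΘ (hball hθ))) (by simpa using h1) hb1int
    have hone : ∀ L : EuclideanSpace ℝ (Fin D) →L[ℝ] ℝ, L.smulRight (1 : ℝ) = L := fun L => by
      ext; simp
    simpa [hone] using this
  · have hW : AEStronglyMeasurable (fun ω => innerSL ℝ (Z ω)) P :=
      (innerSL ℝ (E := EuclideanSpace ℝ (Fin D))).continuous.comp_aestronglyMeasurable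
        hZ.aestronglyMeasurable
    refine hasFDerivAt_integral_ridge (Metric.ball_mem_nhds θ₀ hρ) (hd 1) hballN
      (measurable_iteratedDeriv_succ κ 0) (measurable_iteratedDeriv_succ κ 1)
      hZ.aestronglyMeasurable hW ?_ ?_ hb2int
    · refine (integrable_deriv_mul_norm hκ hc hZ hΘ hN hint (hBΘ hθ₀)).mono'
        ((measurable_iteratedDeriv_inner hZ κ 0 θ₀).aestronglyMeasurable.smul hW)
        (.of_forall fun ω => ?_)
      rw [norm_smul, innerSL_apply_norm, Real.norm_eq_abs]
    · filter_upwards [h2] with ω hω θ hθ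
      rw [innerSL_apply_norm, mul_assoc, ← sq]
      exact hω θ hθ

end Integrability


/-! ### Smoothness, convexity and third derivatives of the empirical loss -/

section EmpiricalLoss

variable {V : Type*} [NormedAddCommGroup V] [InnerProductSpace ℝ V] {κ : ℝ → ℝ} {N : Set ℝ}

theorem iteratedDeriv_three_sub_linear (hκ : AnalyticOnNhd ℝ κ N) (y : ℝ) {t : ℝ} (ht : t ∈ N) :
    iteratedDeriv 3 (fun t => κ t - t * y) t = iteratedDeriv 3 κ t := by
  have hlin : iteratedDeriv 3 (fun t : ℝ => t * y) t = 0 := by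
    simp [iteratedDeriv_succ]
  rw [iteratedDeriv_fun_sub (hκ t ht).contDiffAt (by fun_prop), hlin, sub_zero]

theorem contDiffOn_sub_linear (hκ : AnalyticOnNhd ℝ κ N) (hN : IsOpen N) (n : ℕ) (y : ℝ) :
    ContDiffOn ℝ n (fun t => κ t - t * y) N :=
  (hκ.contDiffOn hN.uniqueDiffOn).sub (by fun_prop)

theorem contDiffOn_average (hκ : AnalyticOnNhd ℝ κ N) (hN : IsOpen N) {B : Set V}
    (x : ℕ → V) (y : ℕ → ℝ) (hB : ∀ θ ∈ B, ∀ i, inner ℝ θ (x i) ∈ N) (n : ℕ) :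
    ContDiffOn ℝ 3 (fun θ : V => (1 / (n : ℝ)) * ∑ i ∈ Finset.range n,
      (κ (inner ℝ θ (x i)) - inner ℝ θ (x i) * y i)) B := by
  refine contDiffOn_const.mul (ContDiffOn.sum fun i _ => ?_)
  exact (contDiffOn_sub_linear hκ hN 3 (y i)).comp (g := fun t => κ t - t * y i)
    (f := fun θ : V => inner ℝ θ (x i)) (contDiff_id.inner ℝ contDiff_const).contDiffOn fun θ hθ => hB θ hθ i

theorem convexOn_average (hκ : ConvexOn ℝ N κ) {Θ : Set V} (hΘ : Convex ℝ Θ)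
    (x : ℕ → V) (y : ℕ → ℝ) (hN : ∀ θ ∈ Θ, ∀ i, inner ℝ θ (x i) ∈ N) (n : ℕ) :
    ConvexOn ℝ Θ (fun θ : V => (1 / (n : ℝ)) * ∑ i ∈ Finset.range n,
      (κ (inner ℝ θ (x i)) - inner ℝ θ (x i) * y i)) := by
  refine ⟨hΘ, fun θ hθ η hη a b ha hb hab => ?_⟩
  simp only [smul_eq_mul]
  rw [mul_left_comm a, mul_left_comm b, ← mul_add, Finset.mul_sum (a := a),
    Finset.mul_sum (a := b), ← Finset.sum_add_distrib]
  gcongr with i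
  have := hκ.2 (hN θ hθ i) (hN η hη i) ha hb hab
  rw [inner_add_left, real_inner_smul_left, real_inner_smul_left]
  simp only [smul_eq_mul] at this
  linarith

/-- The terms in `y` are linear and drop out at third order. The right-hand side is free of `θ`, so
a single application of the strong law controls the whole ball. -/
theorem norm_iteratedFDeriv_three_average_le (hκ : AnalyticOnNhd ℝ κ N) (hN : IsOpen N)
    (x : ℕ → V) (y m : ℕ → ℝ) {θ : V} (hθ : ∀ i, inner ℝ θ (x i) ∈ N)
    (hm : ∀ i, |iteratedDeriv 3 κ (inner ℝ θ (x i))| * ‖x i‖ ^ 3 ≤ m i) (n : ℕ) :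
    ‖iteratedFDeriv ℝ 3 (fun θ : V => (1 / (n : ℝ)) * ∑ i ∈ Finset.range n,
      (κ (inner ℝ θ (x i)) - inner ℝ θ (x i) * y i)) θ‖ ≤
      (∑ i ∈ Finset.range n, m i) / n := by
  have hcd : ∀ i, ContDiffAt ℝ 3 (fun θ : V => κ (inner ℝ θ (x i)) - inner ℝ θ (x i) * y i) θ :=
    fun i => ContDiffAt.comp θ (g := fun t => κ t - t * y i) (f := fun θ : V => inner ℝ θ (x i))
      ((contDiffOn_sub_linear hκ hN 3 (y i)).contDiffAt (hN.mem_nhds (hθ i)))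
      (contDiff_id.inner ℝ contDiff_const).contDiffAt
  simp only [← smul_eq_mul (1 / (n : ℝ))]
  rw [iteratedFDeriv_const_smul_apply' (ContDiffAt.sum fun i _ => hcd i),
    iteratedFDeriv_fun_sum_apply (fun i _ => hcd i), norm_smul, Real.norm_eq_abs,
    abs_of_nonneg (by positivity), one_div, div_eq_inv_mul]
  gcongr
  refine (norm_sum_le _ _).trans (Finset.sum_le_sum fun i _ => ?_)
  refine le_trans ?_ (hm i)
  rw [← iteratedDeriv_three_sub_linear hκ (y i) (hθ i)]
  exact norm_iteratedFDeriv_ridge_le (g := fun t => κ t - t * y i) hN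
    (contDiffOn_sub_linear hκ hN 3 (y i)) (hθ i)

variable {𝓨 : Type*} [MeasurableSpace 𝓨] {Ω : Type*} {D : ℕ}
  {𝓧 : Set (EuclideanSpace ℝ (Fin D))}

theorem empiricalLoss_eq_average [MeasurableSpace Ω] (s : 𝓨 → ℝ) (ν : Measure 𝓨)
    (X : ℕ → Ω → 𝓧) (Y : ℕ → Ω → 𝓨) (ω : Ω) (n : ℕ) :
    empiricalLoss s ν X Y ω n = fun θ : EuclideanSpace ℝ (Fin D) =>
      (1 / (n : ℝ)) * ∑ i ∈ Finset.range n,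
        (logPartition s ν (inner ℝ θ (X i ω : EuclideanSpace ℝ (Fin D))) -
          inner ℝ θ (X i ω : EuclideanSpace ℝ (Fin D)) * s (Y i ω)) := by
  ext θ
  simp only [empiricalLoss, log_density]
  rw [neg_mul, ← mul_neg, ← Finset.sum_neg_distrib]
  simp only [neg_sub]

end EmpiricalLoss

/-! ### Positive definiteness of the Hessian -/

theorem integral_smul_smulRight_apply {V G Ω : Type*} [NormedAddCommGroup V]
    [InnerProductSpace ℝ V] [NormedAddCommGroup G] [NormedSpace ℝ G] [CompleteSpace G]
    [MeasurableSpace Ω] {P : Measure Ω} {Z : Ω → V} {g : Ω → ℝ} {W : Ω → G}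
    (hg : AEStronglyMeasurable g P) (hZ : AEStronglyMeasurable Z P)
    (hW : AEStronglyMeasurable W P) (hint : Integrable (fun ω => |g ω| * (‖Z ω‖ * ‖W ω‖)) P)
    (v : V) :
    (∫ ω, g ω • (innerSL ℝ (Z ω)).smulRight (W ω) ∂P) v = ∫ ω, (g ω * inner ℝ v (Z ω)) • W ω ∂P := by
  have hc : Continuous fun p : (V →L[ℝ] ℝ) × G => p.1.smulRight p.2 :=
    (ContinuousLinearMap.smulRightL ℝ V G).continuous₂
  have hmeas : AEStronglyMeasurable (fun ω => (innerSL ℝ (Z ω)).smulRight (W ω)) P :=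
    hc.comp_aestronglyMeasurable
      (((innerSL ℝ (E := V)).continuous.comp_aestronglyMeasurable hZ).prodMk hW)
  have hint' : Integrable (fun ω => g ω • (innerSL ℝ (Z ω)).smulRight (W ω)) P :=
    hint.mono' (hg.smul hmeas) (.of_forall fun ω => by
      rw [norm_smul, ContinuousLinearMap.norm_smulRight_apply, innerSL_apply_norm,
        Real.norm_eq_abs])
  rw [ContinuousLinearMap.integral_apply hint']
  refine integral_congr_ae (.of_forall fun ω => ?_)
  simp [real_inner_comm, smul_smul]

/-- The Hessian of `θ ↦ E κ(θᵀZ) - ℓ(θ)`, `ℓ` linear, is positive definite. -/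
theorem hasPosDefHessianAt_integral_ridge {D : ℕ} {κ : ℝ → ℝ} {N : Set ℝ}
    {Θ B : Set (EuclideanSpace ℝ (Fin D))}
    {Ω : Type*} [MeasurableSpace Ω] {P : Measure Ω} {Z : Ω → EuclideanSpace ℝ (Fin D)}
    (hκ : AnalyticOnNhd ℝ κ N)
    (hc : ConvexOn ℝ N κ) (hκm : Measurable κ) (hpos : ∀ t ∈ N, 0 < iteratedDeriv 2 κ t)
    (hZ : Measurable Z) (hΘ : IsOpen Θ)
    (hN : ∀ θ ∈ Θ, ∀ ω, inner ℝ θ (Z ω) ∈ N)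
    (hint : ∀ θ ∈ Θ, Integrable (fun ω => κ (inner ℝ θ (Z ω))) P)
    (hB : IsOpen B) (hBΘ : B ⊆ Θ) {M : Ω → ℝ} (hMint : Integrable M P)
    (hM : ∀ᵐ ω ∂P, ∀ θ ∈ B, |iteratedDeriv 3 κ (inner ℝ θ (Z ω))| * ‖Z ω‖ ^ 3 ≤ M ω)
    {θ₀ : EuclideanSpace ℝ (Fin D)} (hθ₀ : θ₀ ∈ B)
    (h_nondeg : ∀ a : EuclideanSpace ℝ (Fin D), (∀ᵐ ω ∂P, inner ℝ a (Z ω) = 0) → a = 0)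
    (ℓ : EuclideanSpace ℝ (Fin D) →L[ℝ] ℝ) {f : EuclideanSpace ℝ (Fin D) → ℝ}
    (hf : ∀ θ ∈ Θ, f θ = ∫ ω, κ (inner ℝ θ (Z ω)) ∂P - ℓ θ) :
    HasPosDefHessianAt f θ₀ := by
  obtain ⟨h1, h2⟩ := hasFDerivAt_fderiv_integral_ridge hκ hc hκm hZ hΘ hN hint hB hBΘ hMint hM hθ₀
  have hf1 : ∀ᶠ θ in 𝓝 θ₀, HasFDerivAt f
      (∫ ω, iteratedDeriv 1 κ (inner ℝ θ (Z ω)) • innerSL ℝ (Z ω) ∂P - ℓ) θ := by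
    filter_upwards [h1, hΘ.mem_nhds (hBΘ hθ₀)] with θ hθ hθΘ
    refine (hθ.sub ℓ.hasFDerivAt).congr_of_eventuallyEq ?_
    filter_upwards [hΘ.mem_nhds hθΘ] with η hη
    exact hf η hη
  have hf2 : HasFDerivAt (fderiv ℝ f) (∫ ω, iteratedDeriv 2 κ (inner ℝ θ₀ (Z ω)) •
        (innerSL ℝ (Z ω)).smulRight (innerSL ℝ (Z ω)) ∂P) θ₀ :=
    (h2.sub_const ℓ).congr_of_eventuallyEq (hf1.mono fun θ hθ => hθ.fderiv)
  refine ⟨hf1.mono fun θ hθ => hθ.differentiableAt, hf2.differentiableAt, fun v hv => ?_⟩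
  have hnorm := integrable_iteratedDeriv_two_mul_norm_sq hκ hc hZ hΘ hN hint hB hBΘ hMint hM hθ₀
  have hm2 := (measurable_iteratedDeriv_inner hZ κ 1 θ₀ (D := D)).aestronglyMeasurable (μ := P)
  have hmv : AEStronglyMeasurable (fun ω => inner ℝ v (Z ω)) P :=
    aestronglyMeasurable_const.inner hZ.aestronglyMeasurable
  have hmL : AEStronglyMeasurable (fun ω => innerSL ℝ (Z ω)) P :=
    (innerSL ℝ (E := EuclideanSpace ℝ (Fin D))).continuous.comp_aestronglyMeasurable
      hZ.aestronglyMeasurable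
  have hv_le : ∀ ω, |inner ℝ v (Z ω)| ≤ ‖v‖ * ‖Z ω‖ := fun ω => abs_real_inner_le_norm _ _
  have hint1 : Integrable (fun ω =>
      (iteratedDeriv 2 κ (inner ℝ θ₀ (Z ω)) * inner ℝ v (Z ω)) • innerSL ℝ (Z ω)) P := by
    refine (hnorm.const_mul ‖v‖).mono' ((hm2.mul hmv).smul hmL) (.of_forall fun ω => ?_)
    rw [norm_smul, innerSL_apply_norm, Real.norm_eq_abs, abs_mul]
    calc _ ≤ |iteratedDeriv 2 κ (inner ℝ θ₀ (Z ω))| * (‖v‖ * ‖Z ω‖) * ‖Z ω‖ := by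
          gcongr
          exact hv_le ω
      _ = _ := by ring
  have happly : ∀ ω, ((iteratedDeriv 2 κ (inner ℝ θ₀ (Z ω)) * inner ℝ v (Z ω)) •
      innerSL ℝ (Z ω)) v = iteratedDeriv 2 κ (inner ℝ θ₀ (Z ω)) * inner ℝ v (Z ω) ^ 2 := by
    intro ω
    rw [smul_apply, innerSL_apply_apply, real_inner_comm v, smul_eq_mul]
    ring
  have heq : fderiv ℝ (fderiv ℝ f) θ₀ v v =
      ∫ ω, iteratedDeriv 2 κ (inner ℝ θ₀ (Z ω)) * inner ℝ v (Z ω) ^ 2 ∂P := by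
    rw [hf2.fderiv, integral_smul_smulRight_apply hm2 hZ.aestronglyMeasurable hmL
      (by simpa only [innerSL_apply_norm, ← sq] using hnorm),
      ContinuousLinearMap.integral_apply hint1]
    exact integral_congr_ae (.of_forall happly)
  have hint2 : Integrable
      (fun ω => iteratedDeriv 2 κ (inner ℝ θ₀ (Z ω)) * inner ℝ v (Z ω) ^ 2) P :=
    (hint1.apply_continuousLinearMap v).congr (.of_forall happly)
  have hnn : 0 ≤ fun ω => iteratedDeriv 2 κ (inner ℝ θ₀ (Z ω)) * inner ℝ v (Z ω) ^ 2 := fun ω =>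
    mul_nonneg (hpos _ (hN θ₀ (hBΘ hθ₀) ω)).le (sq_nonneg _)
  rw [heq]
  -- A vanishing integral of a nonnegative function forces `κ'' (vᵀZ)² = 0` almost surely; as `κ'' >
  -- 0`, nondegeneracy of the covariates gives `v = 0`.
  refine lt_of_le_of_ne (integral_nonneg hnn) fun h0 => hv (h_nondeg v ?_)
  filter_upwards [(integral_eq_zero_iff_of_nonneg hnn hint2).1 h0.symm] with ω hω
  exact pow_eq_zero_iff two_ne_zero |>.1
    ((mul_eq_zero.1 hω).resolve_left (hpos _ (hN θ₀ (hBΘ hθ₀) ω)).ne')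


/-! ### Strong law and almost sure verification of the conditions -/

/-- The strong law of large numbers for a function of i.i.d. random variables. -/
theorem ae_tendsto_average_comp {Ω α : Type*} [MeasurableSpace Ω] [MeasurableSpace α]
    {P : Measure Ω} {ξ : ℕ → Ω → α} (h_indep : iIndepFun ξ P)
    (h_ident : ∀ i, IdentDistrib (ξ i) (ξ 0) P P) {g : α → ℝ} (hg : Measurable g)
    (hint : Integrable (fun ω => g (ξ 0 ω)) P) :
    ∀ᵐ ω ∂P, Tendsto (fun n : ℕ => (∑ i ∈ Finset.range n, g (ξ i ω)) / n) atTop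
      (𝓝 (∫ ω, g (ξ 0 ω) ∂P)) :=
  strong_law_ae_real (fun i ω => g (ξ i ω)) hint
    (fun _ _ hij => (h_indep.comp (fun _ => g) fun _ => hg).indepFun hij)
    fun i => (h_ident i).comp hg

end GLM

end

theorem theorem9 {D d : ℕ}
    -- the exponential family on `𝓨 ⊆ ℝ^d`
    (𝓨 : Set (EuclideanSpace ℝ (Fin d))) (ν : Measure 𝓨) [SigmaFinite ν]
    (s : 𝓨 → ℝ) (hs : Measurable s) (hq : GLM.IsRegularExpFam s ν)
    -- covariates in `𝓧 ⊆ ℝ^D`, coefficients in `Θ ⊆ ℝ^D`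
    (𝓧 Θ : Set (EuclideanSpace ℝ (Fin D))) (hΘ_open : IsOpen Θ) (hΘ_convex : Convex ℝ Θ)
    (hΘ𝓧 : ∀ θ ∈ Θ, ∀ x ∈ 𝓧, inner ℝ θ x ∈ GLM.naturalSpace s ν)
    -- i.i.d. covariate-response pairs
    {Ω : Type*} [MeasurableSpace Ω] (P : Measure Ω) [IsProbabilityMeasure P]
    (X : ℕ → Ω → 𝓧) (Y : ℕ → Ω → 𝓨)
    (hX : ∀ i, Measurable (X i)) (hY : ∀ i, Measurable (Y i))
    (h_indep : iIndepFun (fun i ω => (X i ω, Y i ω)) P)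
    (h_ident : ∀ i, IdentDistrib (fun ω => (X i ω, Y i ω)) (fun ω => (X 0 ω, Y 0 ω)) P P)
    -- `f'(θ₀) = 0`
    (θ₀ : EuclideanSpace ℝ (Fin D)) (hθ₀ : θ₀ ∈ Θ)
    (h_crit : HasFDerivAt (GLM.expectedLoss s ν P (X 0) (Y 0))
      (0 : EuclideanSpace ℝ (Fin D) →L[ℝ] ℝ) θ₀)
    -- moment conditions
    (h_moment : Integrable (fun ω => s (Y 0 ω) • (X 0 ω : EuclideanSpace ℝ (Fin D))) P)
    (h_kappa : ∀ θ ∈ Θ, Integrable (fun ω =>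
      GLM.logPartition s ν (inner ℝ θ (X 0 ω : EuclideanSpace ℝ (Fin D)))) P)
    -- the covariates do not lie a.s. in a proper subspace
    (h_nondeg : ∀ a : EuclideanSpace ℝ (Fin D),
      (∀ᵐ ω ∂P, inner ℝ a (X 0 ω : EuclideanSpace ℝ (Fin D)) = 0) → a = 0)
    -- the open ball `E`, and the third-derivative moment condition on its closure
    (c : EuclideanSpace ℝ (Fin D)) (r : ℝ) (hθ₀_ball : θ₀ ∈ Metric.ball c r)
    (h_ball : closure (Metric.ball c r) ⊆ Θ)
    (h_third : ∀ j k l : Fin D,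
      ∫⁻ ω, ⨆ θ ∈ closure (Metric.ball c r),
        ‖iteratedDeriv 3 (GLM.logPartition s ν)
            (inner ℝ θ (X 0 ω : EuclideanSpace ℝ (Fin D))) *
          (X 0 ω : EuclideanSpace ℝ (Fin D)) j * (X 0 ω : EuclideanSpace ℝ (Fin D)) k *
          (X 0 ω : EuclideanSpace ℝ (Fin D)) l‖ₑ ∂P < ⊤) :
    ∀ᵐ ω ∂P, GLM.BvMConditions Θ (Metric.ball c r) θ₀
      (GLM.empiricalLoss s ν X Y ω) (GLM.expectedLoss s ν P (X 0) (Y 0)) := by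
  set κ := GLM.logPartition s ν with hκ_def
  set N := GLM.naturalSpace s ν with hN_def
  set f := GLM.expectedLoss s ν P (X 0) (Y 0) with hf_def
  have hBΘ : Metric.ball c r ⊆ Θ := subset_closure.trans h_ball
  have hκ : AnalyticOnNhd ℝ κ N := hq.analyticOnNhd
  have hκm : Measurable κ := GLM.measurable_logPartition hs
  have hκc : ConvexOn ℝ N κ := hq.convexOn
  set Z : Ω → EuclideanSpace ℝ (Fin D) := fun ω => (X 0 ω : EuclideanSpace ℝ (Fin D)) with hZ_def
  have hZ : Measurable Z := (hX 0).subtype_val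
  have hNZ : ∀ θ ∈ Θ, ∀ ω, inner ℝ θ (Z ω) ∈ N := fun θ hθ ω => hΘ𝓧 θ hθ _ (X 0 ω).2
  obtain ⟨M, hMm, hMint, hM⟩ := GLM.exists_measurable_third_bound hq.isOpen
    (g := iteratedDeriv 3 κ)
    (fun t ht => (GLM.hasDerivAt_iteratedDeriv hκ 3 ht).continuousAt.continuousWithinAt)
    (GLM.measurable_iteratedDeriv_succ κ 2) (fun θ hθ x hx => hΘ𝓧 θ (hBΘ hθ) x hx) hZ h_third
  have hMZ : Measurable fun ω => M (Z ω) := hMm.comp hZ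
  have hMfin : ∀ᵐ ω ∂P, M (Z ω) ≠ ⊤ := (ae_lt_top hMZ hMint.ne).mono fun _ h => h.ne
  -- `M` may be infinite at some covariates, where `toReal` bounds nothing; identical distribution
  -- excludes this for all data points at once.
  have hMfin_all : ∀ᵐ ω ∂P, ∀ i, M (X i ω : EuclideanSpace ℝ (Fin D)) ≠ ⊤ := by
    refine ae_all_iff.2 fun i => (h_ident i).symm.ae_snd
      (p := fun p : 𝓧 × 𝓨 => M (p.1 : EuclideanSpace ℝ (Fin D)) ≠ ⊤) ?_ hMfin
    exact (hMm.comp measurable_fst.subtype_val) (measurableSet_singleton _).compl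
  have hMrint : Integrable (fun ω => (M (Z ω)).toReal) P :=
    integrable_toReal_of_lintegral_ne_top hMZ.aemeasurable hMint.ne
  have hlin : ∀ θ : EuclideanSpace ℝ (Fin D),
      Integrable (fun ω => inner ℝ θ (Z ω) * s (Y 0 ω)) P := fun θ => by
    refine (h_moment.const_inner θ).congr (.of_forall fun ω => ?_)
    simp only [real_inner_smul_right]
    ring
  have hf : ∀ θ ∈ Θ, f θ = ∫ ω, κ (inner ℝ θ (Z ω)) ∂P -
      innerSL ℝ (∫ ω, s (Y 0 ω) • Z ω ∂P) θ := by
    intro θ hθ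
    rw [innerSL_apply_apply, real_inner_comm, ← integral_inner h_moment]
    simp only [hf_def, GLM.expectedLoss, GLM.log_density, real_inner_smul_right]
    rw [integral_sub (hlin θ) (h_kappa θ hθ), neg_sub]
    simp only [mul_comm, hκ_def, hZ_def]
  have hloss_meas : ∀ θ : EuclideanSpace ℝ (Fin D), Measurable fun p : 𝓧 × 𝓨 =>
      κ (inner ℝ θ (p.1 : EuclideanSpace ℝ (Fin D))) -
        inner ℝ θ (p.1 : EuclideanSpace ℝ (Fin D)) * s p.2 := fun θ => by
    have hin : Measurable fun p : 𝓧 × 𝓨 => inner ℝ θ (p.1 : EuclideanSpace ℝ (Fin D)) :=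
      measurable_const.inner measurable_fst.subtype_val
    exact (hκm.comp hin).sub (hin.mul (hs.comp measurable_snd))
  have hslln : ∀ θ ∈ Θ, ∀ᵐ ω ∂P,
      Tendsto (fun n => GLM.empiricalLoss s ν X Y ω n θ) atTop (𝓝 (f θ)) := by
    intro θ hθ
    filter_upwards [GLM.ae_tendsto_average_comp h_indep h_ident (hloss_meas θ)
      ((h_kappa θ hθ).sub (hlin θ))] with ω hω
    simp only [GLM.empiricalLoss_eq_average]
    convert hω using 2
    · rw [one_div, div_eq_inv_mul]
    · simp only [hf_def, GLM.expectedLoss, GLM.log_density, ← integral_neg, neg_sub, hκ_def]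
  obtain ⟨A, hAc, hAΘ, hA⟩ := GLM.exists_countable_simplex_vertices hΘ_open
  -- Each convexity inequality for `f` is a limit of those for the empirical losses, at any one
  -- outcome where the three relevant averages converge. Convexity then supplies the continuity of
  -- `f` on the open set `Θ`.
  have hconv_f : ConvexOn ℝ Θ f := by
    refine ⟨hΘ_convex, fun θ hθ η hη a b ha hb hab => ?_⟩
    have hζ := hΘ_convex hθ hη ha hb hab
    have hlim : ∀ᵐ ω ∂P, f (a • θ + b • η) ≤ a • f θ + b • f η := by
      filter_upwards [hslln θ hθ, hslln η hη, hslln _ hζ] with ω h1 h2 h3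
      refine le_of_tendsto_of_tendsto' h3 ((h1.const_smul a).add (h2.const_smul b)) fun n => ?_
      rw [GLM.empiricalLoss_eq_average]
      exact (GLM.convexOn_average hκc hΘ_convex _ _
        (fun θ hθ i => hΘ𝓧 θ hθ _ (X i ω).2) n).2 hθ hη ha hb hab
    exact hlim.exists.choose_spec
  have hslln_A : ∀ᵐ ω ∂P, ∀ a ∈ A,
      Tendsto (fun n => GLM.empiricalLoss s ν X Y ω n a) atTop (𝓝 (f a)) :=
    (ae_ball_iff hAc).2 fun a ha => hslln a (hAΘ ha)
  have hslln_M := GLM.ae_tendsto_average_comp h_indep h_ident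
    (g := fun p : 𝓧 × 𝓨 => (M (p.1 : EuclideanSpace ℝ (Fin D))).toReal)
    (hMm.comp measurable_fst.subtype_val).ennreal_toReal hMrint
  filter_upwards [hMfin_all, hslln_A, hslln_M] with ω hω_fin hω_A hω_M
  have hNX : ∀ θ ∈ Θ, ∀ i, inner ℝ θ (X i ω : EuclideanSpace ℝ (Fin D)) ∈ N :=
    fun θ hθ i => hΘ𝓧 θ hθ _ (X i ω).2
  -- This includes `n = 0`, where `1 / 0 = 0` makes the loss identically zero.
  have hconv : ∀ n, ConvexOn ℝ Θ (GLM.empiricalLoss s ν X Y ω n) := fun n => by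
    rw [GLM.empiricalLoss_eq_average]
    exact GLM.convexOn_average hκc hΘ_convex _ _ hNX n
  exact
    { isOpen := Metric.isOpen_ball
      isBounded := Metric.isBounded_ball
      subset := hBΘ
      mem := hθ₀_ball
      contDiffOn := fun n _ => by
        rw [GLM.empiricalLoss_eq_average]
        exact GLM.contDiffOn_average hκ hq.isOpen _ _ (fun θ hθ => hNX θ (hBΘ hθ)) n
      tendsto := GLM.tendsto_of_convexOn_of_simplex_vertices hΘ_open hconv
        (hconv_f.continuousOn hΘ_open) hAΘ hA hω_A
      posDef := GLM.hasPosDefHessianAt_integral_ridge hκ hκc hκm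
        (fun t ht => hq.iteratedDeriv_two_pos ht) hZ hΘ_open hNZ h_kappa Metric.isOpen_ball hBΘ
        hMrint (hMfin.mono fun ω h θ hθ => hM _ (X 0 ω).2 h θ hθ) hθ₀_ball h_nondeg _ hf
      third_bounded := by
        -- A convergent real sequence is bounded, so `C` serves every `n`, not only large ones.
        obtain ⟨C, hC⟩ := hω_M.bddAbove_range
        refine ⟨C, fun n _ θ hθ => ?_⟩
        rw [GLM.empiricalLoss_eq_average]
        exact (GLM.norm_iteratedFDeriv_three_average_le hκ hq.isOpen _ _
          (fun i => (M (X i ω : EuclideanSpace ℝ (Fin D))).toReal) (hNX θ (hBΘ hθ))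
          (fun i => hM _ (X i ω).2 (hω_fin i) θ hθ) n).trans (hC ⟨n, rfl⟩)
      separated_or_convex := Or.inr ⟨fun n _ => hconv n, h_crit⟩ }
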